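/- Let $M\ge 2$, $\beta_1\ge\beta_2>0$, $\gamma_1,\gamma_2>0$ and $0<\rho_{th}<1$. Let $h_1,h_2\sim\mathcal{CN}(0,I_M)$ be independent random vectors in $\mathbb{C}^M$, with absolute correlation coefficient $\rho=|h_1^Hh_2|/(\|h_1\|\,\|h_2\|)$. A base station with $M$ antennas serves two users with channels $\sqrt{\beta_k}\,h_k$, $k=1,2$, using the matched-filter beamformer $b=h_1/\|h_1\|$ and symbol powers $P_1,P_2\ge 0$. It transmits (NOMA with successive interference cancellation) only when $\rho\ge\rho_{th}$ and is silent otherwise. When it transmits, let $P_{\min}$ be the minimum of the total power $P_1+P_2$ over all $P_1,P_2\ge0$ such that $$P_1\beta_1|b^Hh_1|^2\ge\gamma_1\qquad\text{and}\qquad \frac{P_2\beta_k|b^Hh_k|^2}{1+P_1\beta_k|b^Hh_k|^2}\ge\gamma_2\quad(k=1,2).$$ Let $\mathbb{E}[P_{\min}]$ denote the average minimal power over the transmissions, that is, the mean of $P_{\min}$ conditional on the event $\rho\ge\rho_{th}$. Then this event has positive probability, the minimum exists at every outcome in the event, $\mathbb{E}[P_{\min}]$ is finite, and $$\tilde P_{lo}\;\le\;\mathbb{E}[P_{\min}]\;\le\;\tilde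 P_{lo}\Bigl(1+\min\Bigl\{\frac{\beta_2}{\beta_1},\frac{\gamma_2}{\gamma_1}\Bigr\}\Bigr),$$ where $$\tilde P_{lo}=\frac{\gamma_1(1+\gamma_2)}{(M-1)\beta_1}+\frac{\gamma_2}{(M-1)\beta_2\rho_{th}^2}\,F\bigl(1,1;M;1-\rho_{th}^{-2}\bigr)$$ and $F(a,b;c;x)$ is the Gauss hypergeometric function, i.e. the analytic continuation of the Gauss series from $(-1,1)$ to $(-\infty,1)$. -/

import Mathlib

open MeasureTheory ProbabilityTheory
open scoped ENNReal NNReal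

namespace NOMA

noncomputable section

/-! ### The Gauss hypergeometric function on the real half-line `(-∞, 1)` -/

/-- `f` continues the Gauss series `₂F₁(a, b; c; ·)` (which converges on `(-1, 1)`)
analytically to `(-∞, 1)`. -/
def IsGaussContinuation (a b c : ℝ) (f : ℝ → ℝ) : Prop :=
  AnalyticOnNhd ℝ f (Set.Iio 1) ∧
    ∀ x : ℝ, |x| < 1 → f x = ordinaryHypergeometric a b c x

open Classical in
/-- The Gauss hypergeometric function `F(a, b; c; x)` for real `x < 1`: the analytic continuation
of the Gauss series. Mathlib's `ordinaryHypergeometric` is the sum of the series itself and has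
no meaning for `x < -1`. -/
def hypergeometricF (a b c x : ℝ) : ℝ :=
  if h : ∃ f : ℝ → ℝ, IsGaussContinuation a b c f then h.choose x else 0

/-- The continuation is unique on `(-∞, 1)`, so `hypergeometricF` does not depend on a choice. -/
theorem hypergeometricF_eq {a b c : ℝ} {f : ℝ → ℝ} (hf : IsGaussContinuation a b c f)
    {x : ℝ} (hx : x < 1) : hypergeometricF a b c x = f x := by
  have h : ∃ f : ℝ → ℝ, IsGaussContinuation a b c f := ⟨f, hf⟩
  have hg := h.choose_spec
  rw [hypergeometricF, dif_pos h]
  refine hg.1.eqOn_of_preconnected_of_eventuallyEq hf.1 isPreconnected_Iio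
    (z₀ := 0) (by simp) ?_ hx
  filter_upwards [Metric.ball_mem_nhds (0 : ℝ) one_pos] with y hy
  have hy' : |y| < 1 := by simpa using hy
  rw [hg.2 y hy', hf.2 y hy']

/-! ### Rayleigh fading -/

/-- The law `CN(0, 1)` on `ℂ`: real and imaginary parts are independent and `N(0, 1/2)`. -/
def complexGaussian : Measure ℂ :=
  ((gaussianReal 0 (1 / 2)).prod (gaussianReal 0 (1 / 2))).map
    (fun p : ℝ × ℝ => (⟨p.1, p.2⟩ : ℂ))

/-- The law `CN(0, I_M)` on `ℂ^M`: the coordinates are i.i.d. `CN(0, 1)`. -/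
def complexGaussianVec (M : ℕ) : Measure (EuclideanSpace ℂ (Fin M)) :=
  (Measure.pi fun _ : Fin M => complexGaussian).map (WithLp.toLp 2)

/-! ### The two-user system

`inner ℂ b h` is `b^H h` (conjugate-linear in the first argument). -/

variable {M : ℕ}

/-- The absolute correlation coefficient `ρ = |h₁^H h₂| / (‖h₁‖ ‖h₂‖)`. -/
def absCorr (h₁ h₂ : EuclideanSpace ℂ (Fin M)) : ℝ :=
  ‖inner ℂ h₁ h₂‖ / (‖h₁‖ * ‖h₂‖)

/-- The effective gain `β |b^H h|²` of a user with large-scale coefficient `β` and small-scale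
channel `h`, under the beamformer `b`. -/
def gain (β : ℝ) (b h : EuclideanSpace ℂ (Fin M)) : ℝ :=
  β * ‖inner ℂ b h‖ ^ 2

/-- SINR for decoding `s₁` at a user of effective gain `g`, after `s₂` has been cancelled. -/
def sinrS1 (g P₁ : ℝ) : ℝ := P₁ * g

/-- SINR for decoding `s₂` at a user of effective gain `g`, treating `s₁` as noise. -/
def sinrS2 (g P₁ P₂ : ℝ) : ℝ := P₂ * g / (1 + P₁ * g)

/-- The power allocation `(P₁, P₂)` meets the SINR requirements of both users: both decode `s₂`
at level `γ₂`, and User 1 decodes `s₁` at level `γ₁`. -/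
def MeetsQoS (β₁ β₂ γ₁ γ₂ : ℝ) (b h₁ h₂ : EuclideanSpace ℂ (Fin M)) (P₁ P₂ : ℝ) : Prop :=
  γ₂ ≤ min (sinrS2 (gain β₁ b h₁) P₁ P₂) (sinrS2 (gain β₂ b h₂) P₁ P₂) ∧
    γ₁ ≤ sinrS1 (gain β₁ b h₁) P₁

/-- The total transmit powers `P₁ + P₂` of the allocations that meet the requirements. -/
def feasiblePowers (β₁ β₂ γ₁ γ₂ : ℝ) (b h₁ h₂ : EuclideanSpace ℂ (Fin M)) : Set ℝ :=
  {P | ∃ P₁ P₂ : ℝ, 0 ≤ P₁ ∧ 0 ≤ P₂ ∧ MeetsQoS β₁ β₂ γ₁ γ₂ b h₁ h₂ P₁ P₂ ∧ P = P₁ + P₂}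

/-- The matched-filter beamformer along `h`. -/
def mfBeam (h : EuclideanSpace ℂ (Fin M)) : EuclideanSpace ℂ (Fin M) :=
  ((‖h‖⁻¹ : ℝ) : ℂ) • h

/-- The minimal instantaneous transmit power under matched-filter beamforming along `h₁`. -/
def minPower (β₁ β₂ γ₁ γ₂ : ℝ) (h₁ h₂ : EuclideanSpace ℂ (Fin M)) : ℝ :=
  sInf (feasiblePowers β₁ β₂ γ₁ γ₂ (mfBeam h₁) h₁ h₂)

/-- The closed-form bound `P̃_lo`. -/
def powerLo (M : ℕ) (β₁ β₂ γ₁ γ₂ ρth : ℝ) : ℝ :=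
  γ₁ * (1 + γ₂) / (((M : ℝ) - 1) * β₁) +
    γ₂ / (((M : ℝ) - 1) * β₂ * ρth ^ 2) * hypergeometricF 1 1 M (1 - (ρth ^ 2)⁻¹)

end

end NOMA

/-! The minimal power and its mean over the transmission event.

Write `X = ‖h₁‖²` and `Y = |b^H h₂|²`. For given channels the constraints are linear in the powers,
and the cheapest allocation costs
`γ₁ (1 + γ₂) / (β₁ X) + γ₂ max (1 / (β₁ X)) (1 / (β₂ Y))` (`isLeast_feasiblePowers_mfBeam`).
Replacing the maximum by its second entry gives an integrand whose conditional mean is exactly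
`P̃_lo`. Replacing it by the sum of its entries adds `γ₂ / (β₁ X)`, of mean
`γ₂ / ((M - 1) β₁)`; this is at most `γ₂ / γ₁` times the first summand of `P̃_lo`, and at most
`β₂ / β₁` times the second one, because `F(1, 1; M; 1 - ρth⁻²) ≥ ρth²`.

It remains to compute the conditional means of `1 / X` and `1 / Y`. By unitary invariance of
`CN(0, I)` (`map_complexGaussianVec`), given `h₁ ≠ 0` the pair `(Y, ‖h₂‖²)` has the law of
`(A, A + B)` with `A` exponential and `B` an independent sum of `M - 1` exponentials
(`lintegral_inner_mfBeam`), and the event `ρ ≥ ρth` is `A ≥ c B` with `c = ρth² / (1 - ρth²)`.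
That law does not depend on `h₁`, so the event is independent of `X`. Inverse moments come from
`1 / A = ∫₀^∞ exp (-s A) ds` and Laplace transforms, which are elementary for sums of exponentials;
no densities of Gamma or Beta variables are needed. For `Y` this leaves a one-dimensional integral,
which a rational substitution turns into Euler's integral
`(M - 1) ∫₀¹ (1 - s)^(M - 2) / (1 - z s) ds` at `z = 1 - ρth⁻²`
(`lintegral_laplace_eq_eulerIntegral`). Euler's integral is the analytic continuation of the Gauss
series to `z < 1`: it is a continuous functional of `C([0, 1], ℝ)` applied to the inverse of the unit
`1 - z s`, hence analytic, and on `|z| < 1` the geometric series for that inverse is the Gauss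
series. -/

namespace NOMA

noncomputable section

/-! ### Euler's integral for `F(1, 1; M; z)` -/

/-- The Euler integral `(n + 1) ∫₀¹ (1 - s)ⁿ / (1 - z s) ds`, which represents
`F(1, 1; n + 2; z)` for `z < 1`. -/
def eulerIntegral (n : ℕ) (z : ℝ) : ℝ :=
  (n + 1) * ∫ s in (0 : ℝ)..1, (1 - s) ^ n / (1 - z * s)

/-- Integration against the weight `(1 - s)ⁿ` as a continuous functional on `C([0, 1], ℝ)`. -/
def weightedIntegral (n : ℕ) : C(unitInterval, ℝ) →L[ℝ] ℝ :=
  LinearMap.mkContinuous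
    { toFun := fun f => ∫ s : unitInterval, (1 - (s : ℝ)) ^ n * f s
      map_add' := fun f g => by
        simp only [ContinuousMap.add_apply, mul_add]
        exact integral_add (Continuous.integrable_of_hasCompactSupport (by fun_prop)
          (HasCompactSupport.of_compactSpace _))
          (Continuous.integrable_of_hasCompactSupport (by fun_prop)
          (HasCompactSupport.of_compactSpace _))
      map_smul' := fun r f => by
        simp only [ContinuousMap.smul_apply, smul_eq_mul, RingHom.id_apply]
        rw [← integral_const_mul]
        congr 1 with s
        ring } 1 fun f => by
    refine (norm_integral_le_of_norm_le_const (C := ‖f‖) (ae_of_all _ fun s => ?_)).trans ?_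
    · rw [norm_mul, norm_pow]
      have h : ‖1 - (s : ℝ)‖ ≤ 1 := by
        rw [Real.norm_of_nonneg (by linarith [s.2.2])]
        linarith [s.2.1]
      calc ‖1 - (s : ℝ)‖ ^ n * ‖f s‖ ≤ 1 * ‖f‖ := by
            gcongr
            · exact pow_le_one₀ (norm_nonneg _) h
            · exact f.norm_coe_le_norm s
        _ = ‖f‖ := one_mul _
    · simp

theorem weightedIntegral_apply (n : ℕ) (f : C(unitInterval, ℝ)) (g : ℝ → ℝ)
    (hfg : ∀ s : unitInterval, f s = g s) :
    weightedIntegral n f = ∫ s in (0 : ℝ)..1, (1 - s) ^ n * g s := by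
  rw [intervalIntegral.integral_of_le zero_le_one, ← integral_Icc_eq_integral_Ioc,
    ← integral_subtype_comap measurableSet_Icc (fun s => (1 - s) ^ n * g s)]
  change ∫ s : unitInterval, (1 - (s : ℝ)) ^ n * f s = _
  simp only [hfg]
  rfl

/-- The element `1 - z s` of `C([0, 1], ℝ)`. -/
def oneSubMul (z : ℝ) : C(unitInterval, ℝ) := 1 - z • ⟨fun s => (s : ℝ), by fun_prop⟩

theorem one_sub_mul_pos {z s : ℝ} (hz : z < 1) (h0 : 0 ≤ s) (h1 : s ≤ 1) : 0 < 1 - z * s := by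
  rcases le_total z 0 with h | h
  · nlinarith
  · nlinarith

theorem isUnit_oneSubMul {z : ℝ} (hz : z < 1) : IsUnit (oneSubMul z) := by
  rw [ContinuousMap.isUnit_iff_forall_ne_zero]
  intro s
  simpa [oneSubMul] using (one_sub_mul_pos hz s.2.1 s.2.2).ne'

theorem inverse_oneSubMul_apply {z : ℝ} (hz : z < 1) (s : unitInterval) :
    Ring.inverse (oneSubMul z) s = 1 / (1 - z * s) := by
  have h := congrArg (fun f : C(unitInterval, ℝ) => f s)
    (Ring.mul_inverse_cancel _ (isUnit_oneSubMul hz))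
  have hp := one_sub_mul_pos hz s.2.1 s.2.2
  rw [eq_div_iff hp.ne', mul_comm]
  simpa [oneSubMul] using h

theorem eulerIntegral_eq {n : ℕ} {z : ℝ} (hz : z < 1) :
    eulerIntegral n z = (n + 1) * weightedIntegral n (Ring.inverse (oneSubMul z)) := by
  rw [weightedIntegral_apply n _ (fun s => 1 / (1 - z * s)) (inverse_oneSubMul_apply hz),
    eulerIntegral]
  simp only [mul_one_div]

theorem analyticOnNhd_eulerIntegral (n : ℕ) : AnalyticOnNhd ℝ (eulerIntegral n) (Set.Iio 1) := by
  intro z hz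
  obtain ⟨v, hv⟩ := isUnit_oneSubMul hz
  have h1 : AnalyticAt ℝ oneSubMul z := by
    unfold oneSubMul
    exact analyticAt_const.sub (analyticAt_id.smul analyticAt_const)
  have h2 : AnalyticAt ℝ (Ring.inverse : C(unitInterval, ℝ) → _) (oneSubMul z) := by
    rw [← hv]
    exact analyticAt_inverse v
  have h3 : AnalyticAt ℝ (fun z => ((n : ℝ) + 1) *
      weightedIntegral n (Ring.inverse (oneSubMul z))) z :=
    analyticAt_const.mul
      (((weightedIntegral n).analyticAt _).comp (h2.comp h1))
  refine h3.congr ?_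
  filter_upwards [Iio_mem_nhds hz] with y hy
  exact (eulerIntegral_eq hy).symm

/-- The Beta integral `B(k + 1, n + 1)`. -/
theorem integral_one_sub_pow_mul_pow (n k : ℕ) :
    ∫ s in (0 : ℝ)..1, (1 - s) ^ n * s ^ k =
      (k.factorial * n.factorial : ℝ) / (k + n + 1).factorial := by
  induction n generalizing k with
  | zero => simp [integral_pow, Nat.factorial_succ]; field_simp
  | succ n ih =>
    -- `B(k + 1, n + 2) = B(k + 1, n + 1) - B(k + 2, n + 1)` replaces an integration by parts
    have h : ∀ s : ℝ, (1 - s) ^ (n + 1) * s ^ k =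
        (1 - s) ^ n * s ^ k - (1 - s) ^ n * s ^ (k + 1) := fun s => by ring
    simp only [h]
    rw [intervalIntegral.integral_sub
      (Continuous.intervalIntegrable (by fun_prop) _ _)
      (Continuous.intervalIntegrable (by fun_prop) _ _), ih, ih,
      show k + 1 + n + 1 = k + n + 1 + 1 by ring, show k + (n + 1) + 1 = k + n + 1 + 1 by ring]
    simp only [Nat.factorial_succ (k + n + 1), Nat.factorial_succ k, Nat.factorial_succ n]
    have := Nat.factorial_ne_zero (k + n + 1)
    push_cast
    field_simp
    ring

theorem eulerIntegral_eq_ordinaryHypergeometric {n : ℕ} {z : ℝ} (hz : |z| < 1) :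
    eulerIntegral n z = ordinaryHypergeometric (1 : ℝ) (1 : ℝ) ((n + 2 : ℕ) : ℝ) z := by
  rw [eulerIntegral_eq (abs_lt.1 hz).2, ordinaryHypergeometric_eq_tsum]
  set e : C(unitInterval, ℝ) := ⟨fun s => (s : ℝ), by fun_prop⟩ with he
  have hn : ‖z • e‖ < 1 := by
    rw [norm_smul]
    refine lt_of_le_of_lt (mul_le_of_le_one_right (norm_nonneg _) ?_) hz
    rw [ContinuousMap.norm_le _ zero_le_one]
    intro s
    rw [he, ContinuousMap.coe_mk, Real.norm_of_nonneg s.2.1]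
    exact s.2.2
  have h1 : Ring.inverse (oneSubMul z) = ∑' k : ℕ, (z • e) ^ k :=
    (geom_series_eq_inverse _ hn).symm
  rw [h1, (weightedIntegral n).map_tsum (summable_geometric_of_norm_lt_one hn), ← tsum_mul_left]
  congr 1 with k
  rw [smul_pow, map_smul, weightedIntegral_apply n _ (fun s => s ^ k) (fun s => rfl),
    integral_one_sub_pow_mul_pow, ascPochhammer_eval_one,
    ← Nat.cast_ascFactorial]
  have h2 : ((n + 1).factorial : ℝ) * ((n + 2).ascFactorial k : ℝ) = (k + n + 1).factorial := by
    rw [show k + n + 1 = n + 1 + k by ring]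
    exact_mod_cast Nat.factorial_mul_ascFactorial (n + 1) k
  rw [← h2, Nat.factorial_succ n]
  have h3 := Nat.factorial_ne_zero k
  have h4 := Nat.factorial_ne_zero n
  have h5 : ((n + 2).ascFactorial k : ℝ) ≠ 0 := by
    have := Nat.ascFactorial_pos (n + 1) k
    positivity
  simp only [smul_eq_mul]
  push_cast
  field_simp

/-- Euler's integral representation of `F(1, 1; M; z)` on the whole half-line `z < 1`. -/
theorem hypergeometricF_eq_eulerIntegral (n : ℕ) {z : ℝ} (hz : z < 1) :
    hypergeometricF 1 1 ((n + 2 : ℕ) : ℝ) z = eulerIntegral n z :=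
  hypergeometricF_eq ⟨analyticOnNhd_eulerIntegral n,
    fun _ hx => eulerIntegral_eq_ordinaryHypergeometric hx⟩ hz

theorem continuousOn_euler_integrand (n : ℕ) {z : ℝ} (hz : z < 1) :
    ContinuousOn (fun s : ℝ => (1 - s) ^ n / (1 - z * s)) (Set.Icc 0 1) :=
  ContinuousOn.div (by fun_prop) (by fun_prop) fun _ hs => (one_sub_mul_pos hz hs.1 hs.2).ne'

/-- Bounding the denominator `1 - z s` by `1 - z` gives `F(1, 1; n + 2; z) ≥ 1 / (1 - z)` for
`z ≤ 0`. -/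
theorem inv_one_sub_le_eulerIntegral (n : ℕ) {z : ℝ} (hz : z ≤ 0) :
    (1 - z)⁻¹ ≤ eulerIntegral n z := by
  have h1 : (1 - z)⁻¹ = (n + 1) * ∫ s in (0 : ℝ)..1, (1 - s) ^ n * (1 - z)⁻¹ := by
    have h := integral_one_sub_pow_mul_pow n 0
    simp only [pow_zero, mul_one, zero_add, Nat.factorial_zero, Nat.cast_one, one_mul,
      Nat.factorial_succ] at h
    have := Nat.factorial_ne_zero n
    rw [intervalIntegral.integral_mul_const, h]
    push_cast
    field_simp
  rw [h1, eulerIntegral]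
  refine mul_le_mul_of_nonneg_left ?_ (by positivity)
  refine intervalIntegral.integral_mono_on zero_le_one
    (Continuous.intervalIntegrable (by fun_prop) _ _)
    (ContinuousOn.intervalIntegrable ?_) fun s hs => ?_
  · rw [Set.uIcc_of_le zero_le_one]
    exact continuousOn_euler_integrand n (by linarith)
  · have hp := one_sub_mul_pos (z := z) (by linarith) hs.1 hs.2
    have h0 : 0 ≤ 1 - s := by linarith [hs.2]
    rw [div_eq_mul_inv]
    gcongr
    nlinarith [hs.2]

/-! ### Complex Gaussian vectors -/

theorem measurable_complex_mk : Measurable (fun p : ℝ × ℝ => (⟨p.1, p.2⟩ : ℂ)) :=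
  Complex.measurableEquivRealProd.symm.measurable

instance : IsProbabilityMeasure complexGaussian :=
  Measure.isProbabilityMeasure_map measurable_complex_mk.aemeasurable

instance (M : ℕ) : IsProbabilityMeasure (complexGaussianVec M) :=
  Measure.isProbabilityMeasure_map (by fun_prop)

theorem lintegral_sq_Ioi (g : ℝ → ℝ≥0∞) :
    ∫⁻ r in Set.Ioi 0, ENNReal.ofReal (2 * r) * g (r ^ 2) = ∫⁻ a in Set.Ioi 0, g a := by
  have himg : (fun r : ℝ => r ^ 2) '' Set.Ioi 0 = Set.Ioi 0 := by
    ext a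
    constructor
    · rintro ⟨r, hr, rfl⟩
      exact pow_pos (Set.mem_Ioi.1 hr) 2
    · intro ha
      exact ⟨√a, Real.sqrt_pos.2 ha, Real.sq_sqrt (le_of_lt ha)⟩
  have hinj : Set.InjOn (fun r : ℝ => r ^ 2) (Set.Ioi 0) := fun a ha b hb hab =>
    (pow_left_inj₀ (le_of_lt ha) (le_of_lt hb) two_ne_zero).1 hab
  conv_rhs => rw [← himg]
  rw [lintegral_image_eq_lintegral_abs_deriv_mul measurableSet_Ioi
    (fun r _ => (hasDerivAt_pow 2 r).hasDerivWithinAt) hinj]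
  refine setLIntegral_congr_fun measurableSet_Ioi fun r hr => ?_
  have hr' : (0 : ℝ) < r := hr
  simp only [Nat.cast_ofNat, Nat.add_one_sub_one, pow_one]
  rw [abs_of_pos (by positivity)]

/-- Under `CN(0, 1)` the squared modulus is exponentially distributed with rate one. -/
theorem lintegral_norm_sq_complexGaussian {f : ℝ → ℝ≥0∞} (hf : Measurable f) :
    ∫⁻ z, f (‖z‖ ^ 2) ∂complexGaussian =
      ∫⁻ a in Set.Ioi 0, ENNReal.ofReal (Real.exp (-a)) * f a := by
  have hv : (1 / 2 : ℝ≥0) ≠ 0 := by norm_num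
  have hm := measurable_gaussianPDF 0 (1 / 2)
  have hd : ∀ x y : ℝ, gaussianPDF 0 (1 / 2) x * gaussianPDF 0 (1 / 2) y =
      ENNReal.ofReal (Real.pi⁻¹ * Real.exp (-(x ^ 2 + y ^ 2))) := by
    intro x y
    rw [gaussianPDF, gaussianPDF, ← ENNReal.ofReal_mul (gaussianPDFReal_nonneg _ _ _),
      gaussianPDFReal, gaussianPDFReal]
    congr 1
    have h2 : (2 * Real.pi * ((1 / 2 : ℝ≥0) : ℝ)) = Real.pi := by push_cast; ring
    have h3 : (2 * ((1 / 2 : ℝ≥0) : ℝ)) = 1 := by push_cast; ring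
    rw [h2, h3, mul_mul_mul_comm, ← mul_inv, Real.mul_self_sqrt Real.pi_pos.le, ← Real.exp_add]
    ring_nf
  rw [complexGaussian, lintegral_map (by fun_prop) measurable_complex_mk,
    gaussianReal_of_var_ne_zero _ hv, prod_withDensity hm hm]
  rw [lintegral_withDensity_eq_lintegral_mul _ (by fun_prop)
    (by have := measurable_complex_mk; fun_prop), ← Measure.volume_eq_prod,
    ← lintegral_comp_polarCoord_symm]
  have h1 : ∀ p ∈ polarCoord.target, ENNReal.ofReal p.1 •
      ((fun p : ℝ × ℝ => gaussianPDF 0 (1 / 2) p.1 * gaussianPDF 0 (1 / 2) p.2) *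
        fun p : ℝ × ℝ => f (‖(⟨p.1, p.2⟩ : ℂ)‖ ^ 2)) (polarCoord.symm p) =
      ENNReal.ofReal p.1 * (ENNReal.ofReal (Real.pi⁻¹ * Real.exp (-p.1 ^ 2)) * f (p.1 ^ 2)) := by
    intro p _
    have h : (p.1 * Real.cos p.2) ^ 2 + (p.1 * Real.sin p.2) ^ 2 = p.1 ^ 2 := by
      rw [mul_pow, mul_pow, ← mul_add, Real.cos_sq_add_sin_sq, mul_one]
    simp only [polarCoord_symm_apply, Pi.mul_apply, smul_eq_mul, hd, ← Complex.normSq_eq_norm_sq,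
      Complex.normSq_mk, ← pow_two, h]
  rw [setLIntegral_congr_fun polarCoord.open_target.measurableSet h1, polarCoord_target,
    Measure.volume_eq_prod, ← Measure.prod_restrict,
    lintegral_prod _ (by fun_prop)]
  simp only [lintegral_const, Measure.restrict_apply_univ, Real.volume_Ioo]
  rw [← lintegral_sq_Ioi (fun a => ENNReal.ofReal (Real.exp (-a)) * f a)]
  refine setLIntegral_congr_fun measurableSet_Ioi fun r hr => ?_
  have hr' : (0 : ℝ) < r := hr
  have hpi := Real.pi_pos
  have h2 : ENNReal.ofReal r * ENNReal.ofReal (Real.pi⁻¹ * Real.exp (-r ^ 2)) *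
      ENNReal.ofReal (Real.pi - -Real.pi) =
      ENNReal.ofReal (2 * r) * ENNReal.ofReal (Real.exp (-r ^ 2)) := by
    rw [← ENNReal.ofReal_mul hr'.le, ← ENNReal.ofReal_mul (by positivity),
      ← ENNReal.ofReal_mul (by positivity)]
    congr 1
    field_simp
    ring
  calc _ = ENNReal.ofReal r * ENNReal.ofReal (Real.pi⁻¹ * Real.exp (-r ^ 2)) *
      ENNReal.ofReal (Real.pi - -Real.pi) * f (r ^ 2) := by ring
    _ = _ := by rw [h2, mul_assoc]

theorem charFun_complexGaussian (ξ : ℂ) :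
    charFun complexGaussian ξ = Complex.exp (-(‖ξ‖ ^ 2 : ℝ) / 4) := by
  rw [charFun_apply, complexGaussian, integral_map measurable_complex_mk.aemeasurable
    (by fun_prop)]
  have h : ∀ p : ℝ × ℝ, Complex.exp ((inner ℝ (⟨p.1, p.2⟩ : ℂ) ξ : ℝ) * Complex.I) =
      Complex.exp (ξ.re * p.1 * Complex.I) * Complex.exp (ξ.im * p.2 * Complex.I) := by
    intro p
    rw [← Complex.exp_add, Complex.inner]
    congr 1
    simp
    ring
  simp only [h]
  rw [integral_prod_mul (fun x : ℝ => Complex.exp (ξ.re * x * Complex.I))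
    (fun x : ℝ => Complex.exp (ξ.im * x * Complex.I)), ← charFun_apply_real, ← charFun_apply_real,
    charFun_gaussianReal, charFun_gaussianReal, ← Complex.exp_add, ← Complex.normSq_eq_norm_sq,
    Complex.normSq_apply]
  congr 1
  push_cast
  ring

theorem charFun_complexGaussianVec {M : ℕ} (ξ : EuclideanSpace ℂ (Fin M)) :
    charFun (complexGaussianVec M) ξ = Complex.exp (-(‖ξ‖ ^ 2 : ℝ) / 4) := by
  rw [complexGaussianVec]
  refine (charFun_pi (E := fun _ : Fin M => ℂ) ξ).trans ?_
  simp only [charFun_complexGaussian, ← Complex.exp_sum]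
  rw [EuclideanSpace.norm_sq_eq]
  congr 1
  push_cast
  rw [← Finset.sum_neg_distrib, Finset.sum_div]

/-- `CN(0, I_M)` is invariant under unitary maps. -/
theorem map_complexGaussianVec {M : ℕ}
    (U : EuclideanSpace ℂ (Fin M) ≃ₗᵢ[ℂ] EuclideanSpace ℂ (Fin M)) :
    (complexGaussianVec M).map U = complexGaussianVec M := by
  have : IsProbabilityMeasure ((complexGaussianVec M).map U) :=
    Measure.isProbabilityMeasure_map U.continuous.measurable.aemeasurable
  let V : EuclideanSpace ℂ (Fin M) ≃ₗᵢ[ℝ] EuclideanSpace ℂ (Fin M) :=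
    { U.toLinearEquiv.restrictScalars ℝ with norm_map' := U.norm_map }
  refine Measure.ext_of_charFun (funext fun ξ => ?_)
  have h : ∀ x, inner ℝ (U x) ξ = inner ℝ x (V.symm ξ) := fun x => by
    conv_lhs => rw [← V.apply_symm_apply ξ]
    exact V.inner_map_map x (V.symm ξ)
  rw [charFun_apply, integral_map U.continuous.measurable.aemeasurable (by fun_prop)]
  simp only [h]
  rw [← charFun_apply, charFun_complexGaussianVec, charFun_complexGaussianVec, V.symm.norm_map]

/-! ### Laplace transforms and inverse moments -/

theorem lintegral_exp_neg_mul_Ioi {k : ℝ} (hk : 0 < k) (b : ℝ) :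
    ∫⁻ a in Set.Ioi b, ENNReal.ofReal (Real.exp (-(k * a))) =
      ENNReal.ofReal (Real.exp (-(k * b)) / k) := by
  have h := integral_exp_mul_Ioi (neg_lt_zero.2 hk) b
  have hi := integrableOn_exp_mul_Ioi (neg_lt_zero.2 hk) b
  simp only [neg_mul, neg_div_neg_eq] at h hi
  rw [← h, ofReal_integral_eq_lintegral_ofReal hi (ae_of_all _ fun _ => (Real.exp_pos _).le)]

/-- `1 / A = ∫₀^∞ exp (-s A) ds`, valid at `A = 0` in `ℝ≥0∞`. It reduces inverse moments to Laplace
transforms. -/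
theorem inv_ofReal_eq_lintegral {A : ℝ} (hA : 0 ≤ A) :
    (ENNReal.ofReal A)⁻¹ = ∫⁻ s in Set.Ioi (0 : ℝ), ENNReal.ofReal (Real.exp (-(s * A))) := by
  rcases hA.eq_or_lt with rfl | hA
  · simp
  · simp only [mul_comm _ A]
    rw [lintegral_exp_neg_mul_Ioi hA 0, mul_zero, neg_zero, Real.exp_zero, one_div,
      ENNReal.ofReal_inv_of_pos hA]

theorem lintegral_inv_pow_Ioi (n : ℕ) :
    ∫⁻ s in Set.Ioi (0 : ℝ), ENNReal.ofReal (((1 + s) ^ (n + 2))⁻¹) =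
      ENNReal.ofReal (1 / (n + 1)) := by
  have hd : ∀ s ∈ Set.Ici (0 : ℝ), HasDerivAt
      (fun s : ℝ => -(1 / ((n : ℝ) + 1)) * ((1 + s) ^ (n + 1))⁻¹) (((1 + s) ^ (n + 2))⁻¹) s := by
    intro s hs
    have hs' : (0 : ℝ) ≤ s := hs
    have h0 : (1 + s) ≠ 0 := by positivity
    have h1 : (n : ℝ) + 1 ≠ 0 := by positivity
    convert! ((((hasDerivAt_id s).const_add 1).fun_pow (n + 1)).fun_inv
      (pow_ne_zero _ h0)).const_mul (-(1 / ((n : ℝ) + 1))) using 1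
    simp only [id, Nat.add_one_sub_one]
    push_cast
    field_simp
    ring
  have hp : ∀ s ∈ Set.Ioi (0 : ℝ), 0 ≤ ((1 + s) ^ (n + 2))⁻¹ := fun s hs => by
    have hs' : (0 : ℝ) < s := hs
    positivity
  have ht : Filter.Tendsto (fun s : ℝ => -(1 / ((n : ℝ) + 1)) * ((1 + s) ^ (n + 1))⁻¹)
      Filter.atTop (nhds 0) := by
    rw [← mul_zero (-(1 / ((n : ℝ) + 1)))]
    exact ((tendsto_inv_atTop_zero.comp ((Filter.tendsto_pow_atTop n.succ_ne_zero).comp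
      (Filter.tendsto_atTop_add_const_left _ 1 Filter.tendsto_id))).const_mul _)
  have hi := integrableOn_Ioi_deriv_of_nonneg' hd hp ht
  have h := integral_Ioi_of_hasDerivAt_of_nonneg' hd hp ht
  rw [← ofReal_integral_eq_lintegral_ofReal hi
    ((ae_restrict_iff' measurableSet_Ioi).2 (ae_of_all _ hp)), h]
  simp

/-- Separating the first coordinate of a vector of independent `CN(0, 1)` variables: its squared
modulus is exponentially distributed and independent of the others. -/
theorem lintegral_pi_complexGaussian_succ (n : ℕ) {F : ℝ → ℝ → ℝ≥0∞}
    (hF : Measurable (Function.uncurry F)) :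
    ∫⁻ y : Fin (n + 1) → ℂ, F (‖y 0‖ ^ 2) (∑ i, ‖y i‖ ^ 2) ∂(Measure.pi fun _ => complexGaussian) =
      ∫⁻ w : Fin n → ℂ, (∫⁻ a in Set.Ioi 0,
        ENNReal.ofReal (Real.exp (-a)) * F a (a + ∑ i, ‖w i‖ ^ 2))
        ∂(Measure.pi fun _ => complexGaussian) := by
  have hmp := (measurePreserving_piFinSuccAbove (fun _ : Fin (n + 1) => complexGaussian) 0)
  have hG : Measurable fun p : ℂ × (Fin n → ℂ) => F (‖p.1‖ ^ 2) (‖p.1‖ ^ 2 + ∑ i, ‖p.2 i‖ ^ 2) :=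
    hF.comp (f := fun p : ℂ × (Fin n → ℂ) => (‖p.1‖ ^ 2, ‖p.1‖ ^ 2 + ∑ i, ‖p.2 i‖ ^ 2))
      (by fun_prop)
  have h1 := hmp.lintegral_comp hG
  simp only [Fin.sum_univ_succ]
  refine h1.trans ?_
  rw [lintegral_prod_symm _ hG.aemeasurable]
  refine lintegral_congr fun w => ?_
  exact lintegral_norm_sq_complexGaussian (f := fun a => F a (a + ∑ i, ‖w i‖ ^ 2))
    (hF.comp (f := fun a => (a, a + ∑ i, ‖w i‖ ^ 2)) (by fun_prop))

/-- The Laplace transform of the sum of `n` independent exponential variables. -/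
theorem lintegral_exp_neg_sum_norm_sq (n : ℕ) {s : ℝ} (hs : 0 ≤ s) :
    ∫⁻ w : Fin n → ℂ, ENNReal.ofReal (Real.exp (-(s * ∑ i, ‖w i‖ ^ 2)))
      ∂(Measure.pi fun _ => complexGaussian) = ENNReal.ofReal (((1 + s) ^ n)⁻¹) := by
  induction n with
  | zero => simp
  | succ n ih =>
    rw [lintegral_pi_complexGaussian_succ n
      (F := fun _ N => ENNReal.ofReal (Real.exp (-(s * N)))) (by fun_prop)]
    have h : ∀ w : Fin n → ℂ, ∫⁻ a in Set.Ioi 0, ENNReal.ofReal (Real.exp (-a)) *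
        ENNReal.ofReal (Real.exp (-(s * (a + ∑ i, ‖w i‖ ^ 2)))) =
        ENNReal.ofReal ((1 + s)⁻¹) * ENNReal.ofReal (Real.exp (-(s * ∑ i, ‖w i‖ ^ 2))) := by
      intro w
      have h2 := lintegral_exp_neg_mul_Ioi (k := 1 + s) (by positivity) 0
      rw [mul_zero, neg_zero, Real.exp_zero, one_div] at h2
      rw [← h2, ← lintegral_mul_const _ (by fun_prop)]
      refine lintegral_congr fun a => ?_
      rw [← ENNReal.ofReal_mul (Real.exp_pos _).le, ← ENNReal.ofReal_mul (Real.exp_pos _).le,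
        ← Real.exp_add, ← Real.exp_add]
      ring_nf
    simp only [h]
    rw [lintegral_const_mul _ (by fun_prop), ih, ← ENNReal.ofReal_mul (by positivity), ← mul_inv,
      pow_succ']

theorem lintegral_inv_norm_sq (n : ℕ) :
    ∫⁻ x, (ENNReal.ofReal (‖x‖ ^ 2))⁻¹ ∂(complexGaussianVec (n + 2)) =
      ENNReal.ofReal (1 / (n + 1)) := by
  have h0 : ∀ x : EuclideanSpace ℂ (Fin (n + 2)), (ENNReal.ofReal (‖x‖ ^ 2))⁻¹ =
      ∫⁻ s in Set.Ioi (0 : ℝ), ENNReal.ofReal (Real.exp (-(s * ‖x‖ ^ 2))) :=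
    fun x => inv_ofReal_eq_lintegral (sq_nonneg _)
  simp only [h0]
  rw [lintegral_lintegral_swap (by fun_prop), ← lintegral_inv_pow_Ioi]
  refine setLIntegral_congr_fun measurableSet_Ioi fun s hs => ?_
  rw [← lintegral_exp_neg_sum_norm_sq _ (le_of_lt hs), complexGaussianVec,
    lintegral_map (by fun_prop) (by fun_prop)]
  simp only [EuclideanSpace.norm_sq_eq]

theorem norm_mfBeam {M : ℕ} {x : EuclideanSpace ℂ (Fin M)} (hx : x ≠ 0) : ‖mfBeam x‖ = 1 := by
  rw [mfBeam, norm_smul, Complex.norm_real, norm_inv, norm_norm,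
    inv_mul_cancel₀ (norm_ne_zero_iff.2 hx)]

/-- By unitary invariance the projection of a `CN(0, I)` vector on a fixed direction behaves like
its first coordinate, jointly with the norm. -/
theorem lintegral_inner_mfBeam (n : ℕ) {F : ℝ → ℝ → ℝ≥0∞} (hF : Measurable (Function.uncurry F))
    {x : EuclideanSpace ℂ (Fin (n + 1))} (hx : x ≠ 0) :
    ∫⁻ y, F (‖(inner ℂ (mfBeam x) y : ℂ)‖ ^ 2) (‖y‖ ^ 2) ∂(complexGaussianVec (n + 1)) =
      ∫⁻ w : Fin n → ℂ, (∫⁻ a in Set.Ioi 0,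
        ENNReal.ofReal (Real.exp (-a)) * F a (a + ∑ i, ‖w i‖ ^ 2))
        ∂(Measure.pi fun _ => complexGaussian) := by
  have hv : Orthonormal ℂ (({0} : Set (Fin (n + 1))).domRestrict fun _ => mfBeam x) := by
    constructor
    · intro i
      exact norm_mfBeam hx
    · intro i j hij
      exact absurd (Subsingleton.elim i j) hij
  -- in an orthonormal basis starting with the beam, the projection is the first coordinate
  obtain ⟨b, hb⟩ := hv.exists_orthonormalBasis_extension_of_card_eq (by simp)
  have hb0 : b 0 = mfBeam x := hb 0 rfl
  have hG : Measurable fun y : EuclideanSpace ℂ (Fin (n + 1)) => F (‖y 0‖ ^ 2) (‖y‖ ^ 2) :=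
    hF.comp (f := fun y : EuclideanSpace ℂ (Fin (n + 1)) => (‖y 0‖ ^ 2, ‖y‖ ^ 2)) (by fun_prop)
  have h1 : ∀ y, F (‖(inner ℂ (mfBeam x) y : ℂ)‖ ^ 2) (‖y‖ ^ 2) =
      F (‖b.repr y 0‖ ^ 2) (‖b.repr y‖ ^ 2) := fun y => by
    rw [b.repr.norm_map, b.repr_apply_apply, hb0]
  simp only [h1]
  rw [← lintegral_map (f := fun y => F (‖y 0‖ ^ 2) (‖y‖ ^ 2)) hG b.repr.continuous.measurable,
    map_complexGaussianVec, complexGaussianVec, lintegral_map hG (by fun_prop),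
    ← lintegral_pi_complexGaussian_succ n hF]
  simp only [EuclideanSpace.norm_sq_eq]

theorem absCorr_sq {M : ℕ} (x y : EuclideanSpace ℂ (Fin M)) :
    absCorr x y ^ 2 = ‖(inner ℂ (mfBeam x) y : ℂ)‖ ^ 2 / ‖y‖ ^ 2 := by
  have h : ‖(inner ℂ (mfBeam x) y : ℂ)‖ = ‖x‖⁻¹ * ‖(inner ℂ x y : ℂ)‖ := by
    rw [mfBeam, inner_smul_left, norm_mul]
    simp
  rw [h, absCorr, div_pow, mul_pow, mul_pow, inv_pow, div_eq_mul_inv, div_eq_mul_inv, mul_inv]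
  ring

theorem le_absCorr_iff {M : ℕ} {ρ : ℝ} (hρ : 0 < ρ) (x y : EuclideanSpace ℂ (Fin M)) :
    ρ ≤ absCorr x y ↔ ρ ^ 2 ≤ ‖(inner ℂ (mfBeam x) y : ℂ)‖ ^ 2 / ‖y‖ ^ 2 := by
  rw [← absCorr_sq, pow_le_pow_iff_left₀ hρ.le (by unfold absCorr; positivity) two_ne_zero]

/-- The Laplace transform of the effective gain `|b^H h₂|²` on the event `ρ ≥ ρth`, conditional
on the direction of `h₁`. -/
theorem lintegral_exp_neg_gain (n : ℕ) {ρ : ℝ} (hρ : 0 < ρ) (hρ1 : ρ < 1)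
    {x : EuclideanSpace ℂ (Fin (n + 2))} (hx : x ≠ 0) {s : ℝ} (hs : 0 ≤ s) :
    ∫⁻ y, (if ρ ≤ absCorr x y then
        ENNReal.ofReal (Real.exp (-(s * ‖(inner ℂ (mfBeam x) y : ℂ)‖ ^ 2))) else 0)
        ∂(complexGaussianVec (n + 2)) =
      ENNReal.ofReal ((1 + s)⁻¹ * ((1 + (1 + s) * (ρ ^ 2 / (1 - ρ ^ 2))) ^ (n + 1))⁻¹) := by
  have ht : 0 < 1 - ρ ^ 2 := by nlinarith
  simp only [le_absCorr_iff hρ]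
  have hF : Measurable (Function.uncurry fun a N : ℝ =>
      if ρ ^ 2 ≤ a / N then ENNReal.ofReal (Real.exp (-(s * a))) else 0) := by
    refine Measurable.ite (measurableSet_le ?_ ?_) ?_ ?_ <;> fun_prop
  rw [lintegral_inner_mfBeam (n + 1) hF hx]
  set c := ρ ^ 2 / (1 - ρ ^ 2) with hc
  have hc0 : 0 < c := by positivity
  have h : ∀ w : Fin (n + 1) → ℂ, ∫⁻ a in Set.Ioi 0, ENNReal.ofReal (Real.exp (-a)) *
      (if ρ ^ 2 ≤ a / (a + ∑ i, ‖w i‖ ^ 2) then ENNReal.ofReal (Real.exp (-(s * a))) else 0) =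
      ENNReal.ofReal ((1 + s)⁻¹) *
        ENNReal.ofReal (Real.exp (-(((1 + s) * c) * ∑ i, ‖w i‖ ^ 2))) := by
    intro w
    set B := ∑ i, ‖w i‖ ^ 2 with hB
    have hB0 : 0 ≤ B := by positivity
    have h2 := lintegral_exp_neg_mul_Ioi (k := 1 + s) (by positivity) (c * B)
    rw [← ENNReal.ofReal_mul (by positivity), mul_assoc, inv_mul_eq_div, ← h2,
      setLIntegral_congr (Ioi_ae_eq_Ici (a := (0 : ℝ))), ← lintegral_indicator measurableSet_Ici,
      setLIntegral_congr (Ioi_ae_eq_Ici (a := c * B)), ← lintegral_indicator measurableSet_Ici]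
    refine lintegral_congr_ae ?_
    filter_upwards [(compl_mem_ae_iff.2 (measure_singleton (0 : ℝ)) : {(0 : ℝ)}ᶜ ∈ ae volume)]
      with a ha
    have ha0 : a ≠ 0 := ha
    -- the event `ρ ≥ ρth` in terms of the independent exponential sums `a` and `B`
    have key : 0 < a → (ρ ^ 2 ≤ a / (a + B) ↔ c * B ≤ a) := fun hapos => by
      rw [le_div_iff₀ (by positivity), hc, div_mul_eq_mul_div, div_le_iff₀ ht]
      constructor <;> intro h <;> linarith
    by_cases h1 : c * B ≤ a
    · have hapos : 0 < a := lt_of_le_of_ne ((by positivity : 0 ≤ c * B).trans h1) ha0.symm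
      rw [Set.indicator_of_mem (Set.mem_Ici.2 hapos.le), Set.indicator_of_mem (Set.mem_Ici.2 h1),
        if_pos ((key hapos).2 h1), ← ENNReal.ofReal_mul (Real.exp_pos _).le, ← Real.exp_add]
      ring_nf
    · rw [Set.indicator_of_notMem (s := Set.Ici (c * B)) (by simpa using h1)]
      by_cases hapos : 0 < a
      · rw [Set.indicator_of_mem (Set.mem_Ici.2 hapos.le), if_neg (fun h => h1 ((key hapos).1 h)),
          mul_zero]
      · rw [Set.indicator_of_notMem]
        simpa using lt_of_le_of_ne (not_lt.1 hapos) ha0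
  simp only [h]
  rw [lintegral_const_mul _ (by fun_prop), lintegral_exp_neg_sum_norm_sq _ (by positivity),
    ← ENNReal.ofReal_mul (by positivity)]

/-- The substitution `s = t⁻¹ σ / (1 - σ)` turns the integrated Laplace transform into Euler's
integral. -/
theorem lintegral_laplace_eq_eulerIntegral (n : ℕ) {t : ℝ} (ht : 0 < t) (ht1 : t < 1) :
    ∫⁻ s in Set.Ioi (0 : ℝ),
        ENNReal.ofReal ((1 + s)⁻¹ * ((1 + (1 + s) * (t / (1 - t))) ^ (n + 1))⁻¹) =
      ENNReal.ofReal ((1 - t) ^ (n + 1) *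
        (1 / ((n + 1) * t) * eulerIntegral n (1 - t⁻¹))) := by
  have ht' : 0 < 1 - t := by linarith
  have hz : 1 - t⁻¹ < 1 := by have := inv_pos.2 ht; linarith
  have himg : (fun σ : ℝ => t⁻¹ * (σ / (1 - σ))) '' Set.Ioo 0 1 = Set.Ioi 0 := by
    ext s
    constructor
    · rintro ⟨σ, hσ, rfl⟩
      have h1 : 0 < 1 - σ := by linarith [hσ.2]
      have h0 := hσ.1
      exact Set.mem_Ioi.2 (by positivity)
    · intro hs
      have hs' : 0 < s := hs
      have h2 : 0 < 1 + t * s := by positivity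
      refine ⟨t * s / (1 + t * s), ⟨by positivity, by rw [div_lt_one h2]; linarith⟩, ?_⟩
      have h3 : 1 - t * s / (1 + t * s) = 1 / (1 + t * s) := by field_simp; ring
      simp only [h3]
      field_simp
  have hd : ∀ σ ∈ Set.Ioo (0 : ℝ) 1, HasDerivWithinAt (fun σ : ℝ => t⁻¹ * (σ / (1 - σ)))
      (t⁻¹ * (1 / (1 - σ) ^ 2)) (Set.Ioo 0 1) σ := by
    intro σ hσ
    have h1 : 1 - σ ≠ 0 := by linarith [hσ.2]
    convert! (((hasDerivAt_id σ).fun_div ((hasDerivAt_id σ).const_sub 1) h1).const_mul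
      t⁻¹).hasDerivWithinAt using 1
    simp only [id]
    ring
  have hinj : Set.InjOn (fun σ : ℝ => t⁻¹ * (σ / (1 - σ))) (Set.Ioo 0 1) := by
    intro a ha b hb hab
    have h1 : 1 - a ≠ 0 := by linarith [ha.2]
    have h2 : 1 - b ≠ 0 := by linarith [hb.2]
    have h3 := mul_left_cancel₀ (inv_pos.2 ht).ne' hab
    rw [div_eq_div_iff h1 h2] at h3
    linarith
  have hint : IntegrableOn (fun σ : ℝ => (1 - σ) ^ n / (1 - (1 - t⁻¹) * σ)) (Set.Ioc 0 1) :=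
    ((continuousOn_euler_integrand n hz).integrableOn_Icc).mono_set Set.Ioc_subset_Icc_self
  have h4 : (1 - t) ^ (n + 1) * (1 / ((n + 1) * t) * eulerIntegral n (1 - t⁻¹)) =
      ((1 - t) ^ (n + 1) * t⁻¹) *
        ∫ σ in Set.Ioc (0 : ℝ) 1, (1 - σ) ^ n / (1 - (1 - t⁻¹) * σ) := by
    rw [eulerIntegral, intervalIntegral.integral_of_le zero_le_one]
    generalize ∫ σ in Set.Ioc (0 : ℝ) 1, (1 - σ) ^ n / (1 - (1 - t⁻¹) * σ) = J
    field_simp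
  rw [h4, ENNReal.ofReal_mul (by positivity), ofReal_integral_eq_lintegral_ofReal hint
    ((ae_restrict_iff' measurableSet_Ioc).2 (ae_of_all _ fun σ hσ => div_nonneg
      (pow_nonneg (by linarith [hσ.2]) _) (one_sub_mul_pos hz hσ.1.le hσ.2).le)),
    setLIntegral_congr Ioo_ae_eq_Ioc.symm, ← lintegral_const_mul' _ _ ENNReal.ofReal_ne_top,
    ← himg, lintegral_image_eq_lintegral_abs_deriv_mul measurableSet_Ioo hd hinj]
  refine setLIntegral_congr_fun measurableSet_Ioo fun σ hσ => ?_
  have h1 : 0 < 1 - σ := by linarith [hσ.2]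
  have h0 := hσ.1
  have hp := one_sub_mul_pos hz h0.le hσ.2.le
  have h5 : 1 + t⁻¹ * (σ / (1 - σ)) = (1 - (1 - t⁻¹) * σ) / (1 - σ) := by field_simp; ring
  have h6 : 1 + (1 - (1 - t⁻¹) * σ) / (1 - σ) * (t / (1 - t)) = ((1 - t) * (1 - σ))⁻¹ := by
    field_simp
    ring
  simp only [h5, h6]
  rw [abs_of_pos (by positivity), ← ENNReal.ofReal_mul (by positivity),
    ← ENNReal.ofReal_mul (by positivity)]
  congr 1
  rw [inv_pow, inv_inv, inv_div, mul_pow, pow_succ (1 - σ)]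
  field_simp
  ring

/-! ### The minimal power for given channels -/

theorem le_sinrS2_iff {g P₁ P₂ γ : ℝ} (hg : 0 < g) (hP : 0 ≤ P₁) :
    γ ≤ sinrS2 g P₁ P₂ ↔ γ * (g⁻¹ + P₁) ≤ P₂ := by
  rw [sinrS2, le_div_iff₀ (by positivity), ← mul_le_mul_iff_left₀ (b := γ * (g⁻¹ + P₁)) hg,
    show γ * (g⁻¹ + P₁) * g = γ * (1 + P₁ * g) by field_simp]

/-- Both users' requirements on `P₂` are linear in `P₁`, so the cheapest allocation takes the
least admissible `P₁` and then the least admissible `P₂`. -/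
theorem isLeast_feasiblePowers {M : ℕ} {β₁ β₂ γ₁ γ₂ : ℝ} {b h₁ h₂ : EuclideanSpace ℂ (Fin M)}
    (hγ₁ : 0 < γ₁) (hγ₂ : 0 < γ₂) (hg₁ : 0 < gain β₁ b h₁) (hg₂ : 0 < gain β₂ b h₂) :
    IsLeast (feasiblePowers β₁ β₂ γ₁ γ₂ b h₁ h₂)
      (γ₁ * (1 + γ₂) * (gain β₁ b h₁)⁻¹ + γ₂ * max (gain β₁ b h₁)⁻¹ (gain β₂ b h₂)⁻¹) := by
  set g₁ := gain β₁ b h₁ with hg1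
  set g₂ := gain β₂ b h₂ with hg2
  constructor
  · have hP : 0 ≤ γ₁ * g₁⁻¹ := by positivity
    have hm : 0 ≤ max g₁⁻¹ g₂⁻¹ := le_max_of_le_left (by positivity)
    refine ⟨γ₁ * g₁⁻¹, γ₂ * (max g₁⁻¹ g₂⁻¹ + γ₁ * g₁⁻¹), hP, by positivity, ⟨?_, ?_⟩, by ring⟩
    · rw [← hg1, ← hg2, le_min_iff, le_sinrS2_iff hg₁ hP, le_sinrS2_iff hg₂ hP]
      constructor
      · gcongr
        exact le_max_left _ _
      · gcongr
        exact le_max_right _ _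
    · rw [← hg1, sinrS1, inv_mul_cancel_right₀ hg₁.ne']
  · rintro P ⟨P₁, P₂, hP₁, -, ⟨h2, h1⟩, rfl⟩
    rw [← hg1, ← hg2, le_min_iff, le_sinrS2_iff hg₁ hP₁, le_sinrS2_iff hg₂ hP₁] at h2
    rw [← hg1, sinrS1, ← div_le_iff₀ hg₁, div_eq_mul_inv] at h1
    have h3 : γ₂ * (max g₁⁻¹ g₂⁻¹ + P₁) ≤ P₂ := by
      rcases max_cases g₁⁻¹ g₂⁻¹ with h | h
      · rw [h.1]; exact h2.1
      · rw [h.1]; exact h2.2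
    have h4 := mul_le_mul_of_nonneg_left h1 hγ₂.le
    linarith

theorem norm_inner_mfBeam_self {M : ℕ} (x : EuclideanSpace ℂ (Fin M)) :
    ‖(inner ℂ (mfBeam x) x : ℂ)‖ ^ 2 = ‖x‖ ^ 2 := by
  rcases eq_or_ne x 0 with rfl | hx
  · simp
  · have h := norm_ne_zero_iff.2 hx
    rw [mfBeam, inner_smul_left, inner_self_eq_norm_sq_to_K, norm_mul]
    simp
    field_simp

theorem pos_of_le_absCorr {M : ℕ} {ρ : ℝ} (hρ : 0 < ρ) {x y : EuclideanSpace ℂ (Fin M)}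
    (h : ρ ≤ absCorr x y) : 0 < ‖x‖ ^ 2 ∧ 0 < ‖(inner ℂ (mfBeam x) y : ℂ)‖ ^ 2 := by
  constructor
  · refine pow_pos (norm_pos_iff.2 ?_) 2
    rintro rfl
    simp [absCorr] at h
    linarith
  · rw [le_absCorr_iff hρ] at h
    refine lt_of_le_of_ne (by positivity) fun h0 => ?_
    rw [← h0, zero_div] at h
    nlinarith

/-- The minimal power in closed form on the transmission event. -/
theorem isLeast_feasiblePowers_mfBeam {M : ℕ} {β₁ β₂ γ₁ γ₂ ρ : ℝ}
    {x y : EuclideanSpace ℂ (Fin M)} (hβ₁ : 0 < β₁) (hβ₂ : 0 < β₂) (hγ₁ : 0 < γ₁) (hγ₂ : 0 < γ₂)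
    (hρ : 0 < ρ) (h : ρ ≤ absCorr x y) :
    IsLeast (feasiblePowers β₁ β₂ γ₁ γ₂ (mfBeam x) x y)
      (γ₁ * (1 + γ₂) / β₁ * (‖x‖ ^ 2)⁻¹ +
        γ₂ * max ((‖x‖ ^ 2)⁻¹ / β₁) ((‖(inner ℂ (mfBeam x) y : ℂ)‖ ^ 2)⁻¹ / β₂)) := by
  obtain ⟨hx, hy⟩ := pos_of_le_absCorr hρ h
  have h1 : gain β₁ (mfBeam x) x = β₁ * ‖x‖ ^ 2 := by rw [gain, norm_inner_mfBeam_self]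
  convert! isLeast_feasiblePowers hγ₁ hγ₂ (b := mfBeam x) (h₁ := x) (h₂ := y) (β₁ := β₁)
    (β₂ := β₂) (by rw [h1]; positivity) (by rw [gain]; positivity) using 1
  rw [h1, gain, mul_inv, mul_inv]
  simp only [div_eq_inv_mul]
  ring

/-! ### Averages over the transmission event -/

section Event

variable {n : ℕ} {ρ : ℝ}

theorem measurable_inner_mfBeam {M : ℕ} : Measurable
    fun p : EuclideanSpace ℂ (Fin M) × EuclideanSpace ℂ (Fin M) =>
      (inner ℂ (mfBeam p.1) p.2 : ℂ) := by
  unfold mfBeam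
  simp only [inner_smul_left]
  fun_prop

theorem measurable_absCorr {M : ℕ} : Measurable
    fun p : EuclideanSpace ℂ (Fin M) × EuclideanSpace ℂ (Fin M) => absCorr p.1 p.2 := by
  unfold absCorr
  fun_prop

theorem nullMeasurableSet_event {Ω : Type*} [MeasurableSpace Ω] {μ : Measure Ω} {M : ℕ}
    {h₁ h₂ : Ω → EuclideanSpace ℂ (Fin M)}
    (hm₁ : AEMeasurable h₁ μ) (hm₂ : AEMeasurable h₂ μ) :
    NullMeasurableSet {ω | ρ ≤ absCorr (h₁ ω) (h₂ ω)} μ :=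
  (hm₁.prodMk hm₂).nullMeasurableSet_preimage (measurableSet_le measurable_const measurable_absCorr)

/-- In `ℝ≥0∞` the value `0⁻¹ = ⊤` makes the finite inverse moment exclude an atom at `0`. -/
theorem ae_ne_zero_complexGaussianVec (n : ℕ) : ∀ᵐ x ∂(complexGaussianVec (n + 2)), x ≠ 0 := by
  have h := ae_lt_top (μ := complexGaussianVec (n + 2))
    (f := fun x => (ENNReal.ofReal (‖x‖ ^ 2))⁻¹) (by fun_prop)
    (by rw [lintegral_inv_norm_sq]; exact ENNReal.ofReal_ne_top)
  filter_upwards [h] with x hx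
  rintro rfl
  simp at hx

/-- Given `h₁ ≠ 0`, transmission has probability `(1 - ρth²)^(M - 1)`. -/
theorem lintegral_absCorr_indicator (hρ : 0 < ρ) (hρ1 : ρ < 1)
    {x : EuclideanSpace ℂ (Fin (n + 2))} (hx : x ≠ 0) :
    ∫⁻ y, (if ρ ≤ absCorr x y then 1 else 0) ∂(complexGaussianVec (n + 2)) =
      ENNReal.ofReal ((1 - ρ ^ 2) ^ (n + 1)) := by
  have ht : 0 < 1 - ρ ^ 2 := by nlinarith
  have h := lintegral_exp_neg_gain n hρ hρ1 hx le_rfl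
  have h1 : 1 + ρ ^ 2 / (1 - ρ ^ 2) = (1 - ρ ^ 2)⁻¹ := by field_simp; ring
  simpa [h1] using h

/-- Given `h₁ ≠ 0`, the inverse moment of the effective gain `|b^H h₂|²` over the transmission
event. -/
theorem lintegral_inv_gain (hρ : 0 < ρ) (hρ1 : ρ < 1)
    {x : EuclideanSpace ℂ (Fin (n + 2))} (hx : x ≠ 0) :
    ∫⁻ y, (if ρ ≤ absCorr x y then
        (ENNReal.ofReal (‖(inner ℂ (mfBeam x) y : ℂ)‖ ^ 2))⁻¹ else 0)
        ∂(complexGaussianVec (n + 2)) =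
      ENNReal.ofReal ((1 - ρ ^ 2) ^ (n + 1) *
        (1 / ((n + 1) * ρ ^ 2) * eulerIntegral n (1 - (ρ ^ 2)⁻¹))) := by
  have hm : MeasurableSet {p : EuclideanSpace ℂ (Fin (n + 2)) × ℝ | ρ ≤ absCorr x p.1} :=
    measurableSet_le measurable_const
      (measurable_absCorr.comp (f := fun p : EuclideanSpace ℂ (Fin (n + 2)) × ℝ => (x, p.1))
        (by fun_prop))
  have h : ∀ y, (if ρ ≤ absCorr x y then
        (ENNReal.ofReal (‖(inner ℂ (mfBeam x) y : ℂ)‖ ^ 2))⁻¹ else 0) =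
      ∫⁻ s in Set.Ioi (0 : ℝ), (if ρ ≤ absCorr x y then
        ENNReal.ofReal (Real.exp (-(s * ‖(inner ℂ (mfBeam x) y : ℂ)‖ ^ 2))) else 0) := by
    intro y
    split_ifs
    · exact inv_ofReal_eq_lintegral (sq_nonneg _)
    · simp
  simp only [h]
  rw [lintegral_lintegral_swap (Measurable.ite hm (by fun_prop) (by fun_prop)).aemeasurable,
    ← lintegral_laplace_eq_eulerIntegral n (by positivity : 0 < ρ ^ 2) (by nlinarith)]
  exact setLIntegral_congr_fun measurableSet_Ioi fun s hs =>
    lintegral_exp_neg_gain n hρ hρ1 hx (le_of_lt hs)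

variable {Ω : Type*} [MeasurableSpace Ω] {μ : Measure Ω} [IsProbabilityMeasure μ]
  {h₁ h₂ : Ω → EuclideanSpace ℂ (Fin (n + 2))}

/-- Fubini for an integral over the transmission event. -/
theorem setLIntegral_event
    (law₁ : HasLaw h₁ (complexGaussianVec (n + 2)) μ)
    (law₂ : HasLaw h₂ (complexGaussianVec (n + 2)) μ) (hindep : IndepFun h₁ h₂ μ)
    {G : EuclideanSpace ℂ (Fin (n + 2)) × EuclideanSpace ℂ (Fin (n + 2)) → ℝ≥0∞}
    (hG : Measurable G) :
    ∫⁻ ω in {ω | ρ ≤ absCorr (h₁ ω) (h₂ ω)}, G (h₁ ω, h₂ ω) ∂μ =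
      ∫⁻ x, ∫⁻ y, (if ρ ≤ absCorr x y then G (x, y) else 0)
        ∂(complexGaussianVec (n + 2)) ∂(complexGaussianVec (n + 2)) := by
  have hlaw := (indepFun_iff_hasLaw_prodMk_prod law₁ law₂).1 hindep
  have hm : Measurable fun p : EuclideanSpace ℂ (Fin (n + 2)) × EuclideanSpace ℂ (Fin (n + 2)) =>
      if ρ ≤ absCorr p.1 p.2 then G p else 0 :=
    Measurable.ite (measurableSet_le measurable_const measurable_absCorr) hG measurable_const
  rw [← lintegral_indicator₀ (nullMeasurableSet_event law₁.aemeasurable law₂.aemeasurable),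
    ← lintegral_prod _ hm.aemeasurable, ← hlaw.lintegral_comp hm.aemeasurable]
  refine lintegral_congr fun ω => ?_
  by_cases h : ρ ≤ absCorr (h₁ ω) (h₂ ω)
  · rw [Set.indicator_of_mem (show ω ∈ {ω | ρ ≤ absCorr (h₁ ω) (h₂ ω)} from h), if_pos h]
  · rw [Set.indicator_of_notMem (show ω ∉ {ω | ρ ≤ absCorr (h₁ ω) (h₂ ω)} from h), if_neg h]

theorem measure_event (hρ : 0 < ρ) (hρ1 : ρ < 1)
    (law₁ : HasLaw h₁ (complexGaussianVec (n + 2)) μ)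
    (law₂ : HasLaw h₂ (complexGaussianVec (n + 2)) μ) (hindep : IndepFun h₁ h₂ μ) :
    μ {ω | ρ ≤ absCorr (h₁ ω) (h₂ ω)} = ENNReal.ofReal ((1 - ρ ^ 2) ^ (n + 1)) := by
  rw [← setLIntegral_one, setLIntegral_event law₁ law₂ hindep (G := fun _ => 1) measurable_const,
    lintegral_congr_ae (g := fun _ => ENNReal.ofReal ((1 - ρ ^ 2) ^ (n + 1))), lintegral_const,
    measure_univ, mul_one]
  filter_upwards [ae_ne_zero_complexGaussianVec n] with x hx
  exact lintegral_absCorr_indicator hρ hρ1 hx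

/-- Since the conditional probability of transmission given `h₁` is constant, `‖h₁‖` is independent
of the transmission event. -/
theorem setLIntegral_inv_norm_sq (hρ : 0 < ρ) (hρ1 : ρ < 1)
    (law₁ : HasLaw h₁ (complexGaussianVec (n + 2)) μ)
    (law₂ : HasLaw h₂ (complexGaussianVec (n + 2)) μ) (hindep : IndepFun h₁ h₂ μ) :
    ∫⁻ ω in {ω | ρ ≤ absCorr (h₁ ω) (h₂ ω)}, (ENNReal.ofReal (‖h₁ ω‖ ^ 2))⁻¹ ∂μ =
      ENNReal.ofReal ((1 - ρ ^ 2) ^ (n + 1) * (1 / (n + 1))) := by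
  have ht : 0 < 1 - ρ ^ 2 := by nlinarith
  rw [setLIntegral_event law₁ law₂ hindep (G := fun p => (ENNReal.ofReal (‖p.1‖ ^ 2))⁻¹)
    (by fun_prop), ENNReal.ofReal_mul (by positivity), ← lintegral_inv_norm_sq,
    ← lintegral_const_mul _ (by fun_prop)]
  refine lintegral_congr_ae ?_
  filter_upwards [ae_ne_zero_complexGaussianVec n] with x hx
  have hm : Measurable fun y => if ρ ≤ absCorr x y then (1 : ℝ≥0∞) else 0 := Measurable.ite
    (measurableSet_le measurable_const (measurable_absCorr.comp
      (f := fun y : EuclideanSpace ℂ (Fin (n + 2)) => (x, y)) (by fun_prop)))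
    measurable_const measurable_const
  rw [← lintegral_absCorr_indicator hρ hρ1 hx, ← lintegral_mul_const _ hm]
  simp only [ite_mul, one_mul, zero_mul]

theorem setLIntegral_inv_gain (hρ : 0 < ρ) (hρ1 : ρ < 1)
    (law₁ : HasLaw h₁ (complexGaussianVec (n + 2)) μ)
    (law₂ : HasLaw h₂ (complexGaussianVec (n + 2)) μ) (hindep : IndepFun h₁ h₂ μ) :
    ∫⁻ ω in {ω | ρ ≤ absCorr (h₁ ω) (h₂ ω)},
      (ENNReal.ofReal (‖(inner ℂ (mfBeam (h₁ ω)) (h₂ ω) : ℂ)‖ ^ 2))⁻¹ ∂μ =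
      ENNReal.ofReal ((1 - ρ ^ 2) ^ (n + 1) *
        (1 / ((n + 1) * ρ ^ 2) * eulerIntegral n (1 - (ρ ^ 2)⁻¹))) := by
  rw [setLIntegral_event law₁ law₂ hindep
    (G := fun p => (ENNReal.ofReal (‖(inner ℂ (mfBeam p.1) p.2 : ℂ)‖ ^ 2))⁻¹)
    (by have := measurable_inner_mfBeam (M := n + 2); fun_prop)]
  rw [lintegral_congr_ae (g := fun _ => ENNReal.ofReal ((1 - ρ ^ 2) ^ (n + 1) *
        (1 / ((n + 1) * ρ ^ 2) * eulerIntegral n (1 - (ρ ^ 2)⁻¹)))), lintegral_const,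
    measure_univ, mul_one]
  filter_upwards [ae_ne_zero_complexGaussianVec n] with x hx
  exact lintegral_inv_gain hρ hρ1 hx

end Event

/-- Passing from an inverse moment over an event, computed in `ℝ≥0∞`, to a conditional mean. -/
theorem integral_inv_cond {Ω : Type*} [MeasurableSpace Ω] {μ : Measure Ω} {S : Set Ω}
    (hS : NullMeasurableSet S μ) {f : Ω → ℝ} (hf : AEMeasurable f μ) (hpos : ∀ ω ∈ S, 0 < f ω)
    {p J : ℝ} (hp : 0 < p) (hJ : 0 ≤ J) (hμ : μ S = ENNReal.ofReal p)
    (hint : ∫⁻ ω in S, (ENNReal.ofReal (f ω))⁻¹ ∂μ = ENNReal.ofReal (p * J)) :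
    Integrable (fun ω => (f ω)⁻¹) (μ[|S]) ∧ ∫ ω, (f ω)⁻¹ ∂(μ[|S]) = J := by
  have hae : ∀ᵐ ω ∂(μ.restrict S), ω ∈ S := ae_restrict_mem₀ hS
  have hac : μ[|S] ≪ μ.restrict S := Measure.smul_absolutelyContinuous
  have h0 : 0 ≤ᵐ[μ[|S]] fun ω => (f ω)⁻¹ := by
    filter_upwards [hac.ae_le hae] with ω hω
    exact inv_nonneg.2 (hpos ω hω).le
  have hm : AEStronglyMeasurable (fun ω => (f ω)⁻¹) (μ[|S]) :=
    ((hf.inv.restrict (s := S)).mono_ac hac).aestronglyMeasurable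
  have hl : ∫⁻ ω, ENNReal.ofReal (f ω)⁻¹ ∂(μ[|S]) = ENNReal.ofReal J := by
    rw [ProbabilityTheory.cond, lintegral_smul_measure, lintegral_congr_ae
      (g := fun ω => (ENNReal.ofReal (f ω))⁻¹), hint, hμ, ENNReal.ofReal_mul hp.le, smul_eq_mul,
      ← mul_assoc, ENNReal.inv_mul_cancel (by simpa using hp) ENNReal.ofReal_ne_top, one_mul]
    filter_upwards [hae] with ω hω
    exact ENNReal.ofReal_inv_of_pos (hpos ω hω)
  constructor
  · rw [← lintegral_ofReal_ne_top_iff_integrable hm h0, hl]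
    exact ENNReal.ofReal_ne_top
  · rw [integral_eq_lintegral_of_nonneg_ae h0 hm, hl, ENNReal.toReal_ofReal hJ]

end

end NOMA

/-- The average minimal transmit power is the mean of `minPower` given that the base station
transmits, i.e. under `μ[|ρ ≥ ρth]`. On that event the minimum exists. -/
theorem theorem1 {Ω : Type*} [MeasurableSpace Ω] (μ : Measure Ω) [IsProbabilityMeasure μ]
    (M : ℕ) (hM : 2 ≤ M)
    (h₁ h₂ : Ω → EuclideanSpace ℂ (Fin M))
    (law₁ : HasLaw h₁ (NOMA.complexGaussianVec M) μ)
    (law₂ : HasLaw h₂ (NOMA.complexGaussianVec M) μ)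
    (hindep : IndepFun h₁ h₂ μ)
    (β₁ β₂ γ₁ γ₂ ρth : ℝ) (hβ₂ : 0 < β₂) (hβ : β₂ ≤ β₁) (hγ₁ : 0 < γ₁) (hγ₂ : 0 < γ₂)
    (hρ₀ : 0 < ρth) (hρ₁ : ρth < 1) :
    0 < μ {ω | ρth ≤ NOMA.absCorr (h₁ ω) (h₂ ω)} ∧
    (∀ ω, ρth ≤ NOMA.absCorr (h₁ ω) (h₂ ω) →
      IsLeast (NOMA.feasiblePowers β₁ β₂ γ₁ γ₂ (NOMA.mfBeam (h₁ ω)) (h₁ ω) (h₂ ω))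
        (NOMA.minPower β₁ β₂ γ₁ γ₂ (h₁ ω) (h₂ ω))) ∧
    Integrable (fun ω => NOMA.minPower β₁ β₂ γ₁ γ₂ (h₁ ω) (h₂ ω))
      (μ[|{ω | ρth ≤ NOMA.absCorr (h₁ ω) (h₂ ω)}]) ∧
    NOMA.powerLo M β₁ β₂ γ₁ γ₂ ρth ≤
      ∫ ω, NOMA.minPower β₁ β₂ γ₁ γ₂ (h₁ ω) (h₂ ω)
        ∂(μ[|{ω | ρth ≤ NOMA.absCorr (h₁ ω) (h₂ ω)}]) ∧
    ∫ ω, NOMA.minPower β₁ β₂ γ₁ γ₂ (h₁ ω) (h₂ ω)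
        ∂(μ[|{ω | ρth ≤ NOMA.absCorr (h₁ ω) (h₂ ω)}]) ≤
      NOMA.powerLo M β₁ β₂ γ₁ γ₂ ρth * (1 + min (β₂ / β₁) (γ₂ / γ₁)) := by
  obtain ⟨n, rfl⟩ : ∃ n, M = n + 2 := ⟨M - 2, by omega⟩
  have hβ₁ : 0 < β₁ := hβ₂.trans_le hβ
  have ht : 0 < 1 - ρth ^ 2 := by nlinarith
  have hz : 1 - (ρth ^ 2)⁻¹ ≤ 0 := by
    rw [sub_nonpos]
    exact (one_le_inv₀ (by positivity)).2 (by linarith)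
  set S := {ω | ρth ≤ NOMA.absCorr (h₁ ω) (h₂ ω)}
  set E := NOMA.eulerIntegral n (1 - (ρth ^ 2)⁻¹) with hE
  have hEt : ρth ^ 2 ≤ E := by
    have h := NOMA.inv_one_sub_le_eulerIntegral n hz
    rwa [sub_sub_cancel, inv_inv] at h
  have hS : NullMeasurableSet S μ :=
    NOMA.nullMeasurableSet_event law₁.aemeasurable law₂.aemeasurable
  have hμ : μ S = ENNReal.ofReal ((1 - ρth ^ 2) ^ (n + 1)) :=
    NOMA.measure_event hρ₀ hρ₁ law₁ law₂ hindep
  have hμ0 : 0 < μ S := by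
    rw [hμ, ENNReal.ofReal_pos]
    positivity
  obtain ⟨hU, hU'⟩ := NOMA.integral_inv_cond hS (f := fun ω => ‖h₁ ω‖ ^ 2)
    (by have := law₁.aemeasurable; fun_prop)
    (fun ω hω => (NOMA.pos_of_le_absCorr hρ₀ hω).1) (pow_pos ht _) (by positivity) hμ
    (NOMA.setLIntegral_inv_norm_sq hρ₀ hρ₁ law₁ law₂ hindep)
  have hE0 : 0 ≤ E := le_trans (by positivity) hEt
  obtain ⟨hV, hV'⟩ := NOMA.integral_inv_cond hS
    (f := fun ω => ‖(inner ℂ (NOMA.mfBeam (h₁ ω)) (h₂ ω) : ℂ)‖ ^ 2)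
    ((NOMA.measurable_inner_mfBeam.comp_aemeasurable
      (law₁.aemeasurable.prodMk law₂.aemeasurable)).norm.pow_const 2)
    (fun ω hω => (NOMA.pos_of_le_absCorr hρ₀ hω).2) (pow_pos ht _) (by positivity) hμ
    (NOMA.setLIntegral_inv_gain hρ₀ hρ₁ law₁ law₂ hindep)
  have hleast := fun ω (hω : ρth ≤ NOMA.absCorr (h₁ ω) (h₂ ω)) =>
    NOMA.isLeast_feasiblePowers_mfBeam hβ₁ hβ₂ hγ₁ hγ₂ hρ₀ hω
  have hmin := fun ω (hω : ρth ≤ NOMA.absCorr (h₁ ω) (h₂ ω)) => (hleast ω hω).csInf_eq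
  set U : Ω → ℝ := fun ω => (‖h₁ ω‖ ^ 2)⁻¹
  set V : Ω → ℝ := fun ω => (‖(inner ℂ (NOMA.mfBeam (h₁ ω)) (h₂ ω) : ℂ)‖ ^ 2)⁻¹
  have hae : ∀ᵐ ω ∂(μ[|S]), NOMA.minPower β₁ β₂ γ₁ γ₂ (h₁ ω) (h₂ ω) =
      γ₁ * (1 + γ₂) / β₁ * U ω + γ₂ * max (U ω / β₁) (V ω / β₂) := by
    filter_upwards [Measure.smul_absolutelyContinuous.ae_le (ae_restrict_mem₀ hS)] with ω hω
    exact hmin ω hω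
  have hmax : Integrable (fun ω => max (U ω / β₁) (V ω / β₂)) (μ[|S]) :=
    (hU.div_const β₁).sup (hV.div_const β₂)
  have hint := (hU.const_mul (γ₁ * (1 + γ₂) / β₁)).add (hmax.const_mul γ₂)
  have hlo : NOMA.powerLo (n + 2) β₁ β₂ γ₁ γ₂ ρth = γ₁ * (1 + γ₂) / β₁ * (1 / (n + 1)) +
      γ₂ * (1 / ((n + 1) * ρth ^ 2) * E / β₂) := by
    rw [NOMA.powerLo, NOMA.hypergeometricF_eq_eulerIntegral n (by linarith), ← hE,
      show (((n + 2 : ℕ) : ℝ) - 1) = n + 1 by push_cast; ring]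
    field_simp
  have hEP : ∫ ω, NOMA.minPower β₁ β₂ γ₁ γ₂ (h₁ ω) (h₂ ω) ∂(μ[|S]) =
      γ₁ * (1 + γ₂) / β₁ * (1 / (n + 1)) +
        γ₂ * ∫ ω, max (U ω / β₁) (V ω / β₂) ∂(μ[|S]) := by
    rw [integral_congr_ae hae, integral_add (hU.const_mul _) (hmax.const_mul _),
      integral_const_mul, integral_const_mul, hU']
  have hmax_lo : 1 / ((n + 1) * ρth ^ 2) * E / β₂ ≤
      ∫ ω, max (U ω / β₁) (V ω / β₂) ∂(μ[|S]) := by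
    rw [← hV', ← integral_div]
    exact integral_mono (hV.div_const _) hmax fun ω => le_max_right _ _
  have hmax_up : ∫ ω, max (U ω / β₁) (V ω / β₂) ∂(μ[|S]) ≤
      1 / (n + 1) / β₁ + 1 / ((n + 1) * ρth ^ 2) * E / β₂ := by
    rw [← hV', ← hU', ← integral_div, ← integral_div, ← integral_add (hU.div_const _)
      (hV.div_const _)]
    refine integral_mono hmax ((hU.div_const _).add (hV.div_const _)) fun ω => ?_
    have h1 : 0 ≤ U ω / β₁ := by positivity
    have h2 : 0 ≤ V ω / β₂ := by positivity
    exact max_le (le_add_of_nonneg_right h2) (le_add_of_nonneg_left h1)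
  refine ⟨hμ0, fun ω hω => ?_, hint.congr (hae.mono fun _ h => h.symm), ?_, ?_⟩
  · rw [NOMA.minPower, hmin ω hω]
    exact hleast ω hω
  · rw [hEP, hlo]
    gcongr
  · have hterm₁ : 0 ≤ γ₁ * (1 + γ₂) / β₁ * (1 / ((n : ℝ) + 1)) := by positivity
    have hterm₂ : 0 ≤ γ₂ * (1 / (((n : ℝ) + 1) * ρth ^ 2) * E / β₂) := by positivity
    -- the mean of the surplus `γ₂ / (β₁ X)` left by bounding the maximum by the sum
    have hkey : γ₂ * (1 / ((n : ℝ) + 1) / β₁) ≤ (γ₁ * (1 + γ₂) / β₁ * (1 / (n + 1)) +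
      γ₂ * (1 / ((n + 1) * ρth ^ 2) * E / β₂)) * min (β₂ / β₁) (γ₂ / γ₁) := by
      rcases min_cases (β₂ / β₁) (γ₂ / γ₁) with h | h
      · -- the second summand of the lower bound suffices, since `F(1, 1; M; 1 - t⁻¹) ≥ t`
        rw [h.1]
        refine le_trans ?_ (mul_le_mul_of_nonneg_right (le_add_of_nonneg_left hterm₁)
          (by positivity))
        have h1 : γ₂ * (1 / (((n : ℝ) + 1) * ρth ^ 2) * E / β₂) * (β₂ / β₁) =
            γ₂ * (1 / ((n : ℝ) + 1) / β₁) * (E / ρth ^ 2) := by field_simp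
        rw [h1]
        exact le_mul_of_one_le_right (by positivity) ((one_le_div (by positivity)).2 hEt)
      · -- the first summand suffices
        rw [h.1]
        refine le_trans ?_ (mul_le_mul_of_nonneg_right (le_add_of_nonneg_right hterm₂)
          (by positivity))
        have h1 : γ₁ * (1 + γ₂) / β₁ * (1 / ((n : ℝ) + 1)) * (γ₂ / γ₁) =
            γ₂ * (1 / ((n : ℝ) + 1) / β₁) * (1 + γ₂) := by field_simp
        rw [h1]
        exact le_mul_of_one_le_right (by positivity) (by linarith)
    rw [hEP, mul_one_add (NOMA.powerLo (n + 2) _ _ _ _ _), hlo]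
    have := mul_le_mul_of_nonneg_left hmax_up hγ₂.le
    rw [mul_add] at this
    linarith
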